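/- **Theorem (SPD MLR under a PEM).** Let $\mathrm{Sym}(n)$ be the space of real symmetric $n\times n$ matrices with the Frobenius inner product $\langle\cdot,\cdot\rangle$, let $\mathrm{SPD}(n)\subset\mathrm{Sym}(n)$ be the open set of positive definite matrices, and let $\phi:\mathrm{SPD}(n)\to\mathrm{Sym}(n)$ be a ($C^\infty$) diffeomorphism with differential $\phi_{*,P}$ at $P$. Equip $\mathrm{SPD}(n)$ with the pullback Euclidean metric (PEM) $g_P(V,W)=\langle\phi_{*,P}V,\phi_{*,P}W\rangle$. Let $d$ be its geodesic distance, $\mathrm{Log}_P S$ its Riemannian logarithm (the initial velocity of the geodesic $\gamma:[0,1]\to\mathrm{SPD}(n)$ from $P$ to $S$), and $\Gamma_{P\to Q}:T_P\mathrm{SPD}(n)\to T_Q\mathrm{SPD}(n)$ the Levi-Civita parallel transport along the geodesic from $P$ to $Q$; under $g$ both are well defined for all pairs of points. For $P\in\mathrm{SPD}(n)$ and $A\in T_P\mathrm{SPD}(n)\setminus\{0\}$ the SPD hyperplane is $$\tilde H_{A,P}=\{S\in\mathrm{SPD}(n): g_P(\mathrm{Log}_P S,A)=0\},$$ and, given $C$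 classes with parameters $P_k\in\mathrm{SPD}(n)$ and $A_k\in T_{P_k}\mathrm{SPD}(n)\setminus\{0\}$ $(1\le k\le C)$, the SPD multinomial logistic regression (SPD MLR) is the probability distribution on $\{1,\dots,C\}$ given by $$p(y=k\mid S)\propto\exp\Bigl(\operatorname{sign}\bigl(g_{P_k}(A_k,\mathrm{Log}_{P_k}S)\bigr)\,\|A_k\|_{P_k}\,\inf_{Q\in\tilde H_{A_k,P_k}}d(S,Q)\Bigr),\qquad \|A\|_P=\sqrt{g_P(A,A)} .$$ Let $\tilde A_k\in T_I\mathrm{SPD}(n)\setminus\{0\}\cong\mathrm{Sym}(n)\setminus\{0\}$ and $P_k\in\mathrm{SPD}(n)$ for $1\le k\le C$, and put $A_k=\Gamma_{I\to P_k}(\tilde A_k)$, where $I$ is the identity matrix. Then $A_k\neq0$, and for all $S\in\mathrm{SPD}(n)$ and all $k$ $$p(y=k\mid S)=\frac{\exp\langle\phi(S)-\phi(P_k),\phi_{*,I}(\tilde A_k)\rangle}{\sum_{j=1}^{C}\exp\langle\phi(S)-\phi(P_j),\phi_{*,I}(\tilde A_j)\rangle},$$ that is, $p(y=k\mid S)\propto\exp\langle\phi(S)-\phi(P_k),\phi_{*,I}(\tilde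 A_k)\rangle$; moreover $$\tilde H_{A_k,P_k}=\{S\in\mathrm{SPD}(n):\langle\phi(S)-\phi(P_k),\phi_{*,I}(\tilde A_k)\rangle=0\}.$$ -/

import Mathlib

open scoped Manifold ContDiff RealInnerProductSpace

noncomputable section

/-- The space of real symmetric `n × n` matrices. -/
def SymMat (n : ℕ) : Type := {A : Matrix (Fin n) (Fin n) ℝ // A.IsSymm}

namespace SymMat

/-- The symmetric matrices as a linear subspace of all matrices. -/
def submodule (n : ℕ) : Submodule ℝ (Matrix (Fin n) (Fin n) ℝ) where
  carrier := {A | A.IsSymm}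
  add_mem' hA hB := Matrix.IsSymm.add hA hB
  zero_mem' := Matrix.isSymm_zero
  smul_mem' c _ hA := Matrix.IsSymm.smul hA c

/-- The additive group of symmetric matrices, entrywise. -/
@[reducible]
def addCommGroup (n : ℕ) : AddCommGroup (SymMat n) := inferInstanceAs (AddCommGroup (submodule n))

attribute [local instance] addCommGroup in
/-- Entrywise scalar multiplication. -/
@[reducible]
def module (n : ℕ) : Module ℝ (SymMat n) := inferInstanceAs (Module ℝ (submodule n))

attribute [local instance] addCommGroup module in
/-- The Frobenius inner product `⟨A, B⟩ = tr (Aᵀ B)`. -/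
@[reducible]
def frobeniusCore (n : ℕ) : InnerProductSpace.Core ℝ (SymMat n) where
  inner A B := (A.1.transpose * B.1).trace
  conj_inner_symm A B := by
    change (B.1.transpose * A.1).trace = (A.1.transpose * B.1).trace
    rw [← Matrix.trace_transpose (B.1.transpose * A.1), Matrix.transpose_mul,
      Matrix.transpose_transpose]
  re_inner_nonneg A := by
    change 0 ≤ (A.1.transpose * A.1).trace
    exact (Matrix.posSemidef_conjTranspose_mul_self A.1).trace_nonneg
  add_left A B C := by
    change ((A.1 + B.1).transpose * C.1).trace = _
    rw [Matrix.transpose_add, Matrix.add_mul, Matrix.trace_add]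
  smul_left A B r := by
    change ((r • A.1).transpose * B.1).trace = r * (A.1.transpose * B.1).trace
    rw [Matrix.transpose_smul, Matrix.smul_mul, Matrix.trace_smul, smul_eq_mul]
  definite A h := by
    have h' : A.1 = 0 := Matrix.trace_conjTranspose_mul_self_eq_zero_iff.1 h
    exact Subtype.ext h'

/-- The Frobenius norm. -/
instance (n : ℕ) : NormedAddCommGroup (SymMat n) :=
  @InnerProductSpace.Core.toNormedAddCommGroup ℝ (SymMat n) _ (addCommGroup n) (module n)
    (frobeniusCore n)

instance (n : ℕ) : InnerProductSpace ℝ (SymMat n) :=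
  letI := addCommGroup n
  letI := module n
  InnerProductSpace.ofCore (frobeniusCore n).toCore

instance (n : ℕ) : FiniteDimensional ℝ (SymMat n) :=
  inferInstanceAs (FiniteDimensional ℝ (submodule n))

end SymMat

/-- The positive definite matrices form an open subset of the symmetric matrices. -/
theorem SymMat.isOpen_posDef (n : ℕ) : IsOpen {A : SymMat n | A.1.PosDef} := by
  have h1 : Continuous fun p : SymMat n => p.1 :=
    LinearMap.continuous_of_finiteDimensional
      ({ toFun := fun A => A.1, map_add' := fun _ _ => rfl, map_smul' := fun _ _ => rfl } :
        SymMat n →ₗ[ℝ] Matrix (Fin n) (Fin n) ℝ)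
  have hc : Continuous fun p : SymMat n × (Fin n → ℝ) => p.2 ⬝ᵥ (p.1.1.mulVec p.2) := by
    exact continuous_snd.dotProduct ((h1.comp continuous_fst).matrix_mulVec continuous_snd)
  have hset : {A : SymMat n | A.1.PosDef} =
      {A | ∀ x ∈ Metric.sphere (0 : Fin n → ℝ) 1, 0 < x ⬝ᵥ (A.1.mulVec x)} := by
    ext A
    constructor
    · intro hA x hx
      exact hA.dotProduct_mulVec_pos (ne_zero_of_mem_unit_sphere ⟨x, hx⟩)
    · intro hA
      refine Matrix.PosDef.of_dotProduct_mulVec_pos A.2 fun x hx => ?_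
      have hn : 0 < ‖x‖ := norm_pos_iff.2 hx
      have := hA (‖x‖⁻¹ • x) (by simp [norm_smul, hn.ne'])
      rw [Matrix.mulVec_smul, smul_dotProduct, dotProduct_smul, smul_smul, smul_eq_mul] at this
      exact pos_of_mul_pos_right this (by positivity)
  rw [hset, isOpen_iff_mem_nhds]
  intro A hA
  refine (isCompact_sphere (0 : Fin n → ℝ) 1).eventually_forall_of_forall_eventually
    fun x hx => ?_
  exact hc.continuousAt.eventually (lt_mem_nhds (hA x hx))

/-- The manifold of symmetric positive definite matrices: an open subset of `SymMat n`, with the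
smooth structure that it inherits from this vector space. -/
def SPD (n : ℕ) : TopologicalSpace.Opens (SymMat n) :=
  ⟨{A | A.1.PosDef}, SymMat.isOpen_posDef n⟩

namespace SPD

variable {n : ℕ}

/-- The identity matrix. -/
def one (n : ℕ) : SPD n := ⟨⟨1, Matrix.isSymm_one⟩, Matrix.PosDef.one⟩

/-- The tangent space of `SPD n` at `P`, which is `SymMat n` by definition. -/
abbrev T (P : SPD n) : Type := TangentSpace 𝓘(ℝ, SymMat n) P

/-- Smooth Riemannian metrics on the manifold `SPD n`. -/
abbrev Metric (n : ℕ) : Type :=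
  Bundle.ContMDiffRiemannianMetric 𝓘(ℝ, SymMat n) ∞ (SymMat n)
    (fun P : SPD n => TangentSpace 𝓘(ℝ, SymMat n) P)

/-- Diffeomorphisms from `SPD n` onto `SymMat n`. -/
abbrev Diffeo (n : ℕ) : Type :=
  Diffeomorph 𝓘(ℝ, SymMat n) 𝓘(ℝ, SymMat n) (SPD n) (SymMat n) ∞

/-- The differential `φ_{*,P} : T_P SPD(n) → T_{φ(P)} Sym(n) = Sym(n)`. -/
def diff (φ : Diffeo n) (P : SPD n) : T P →L[ℝ] SymMat n :=
  mfderiv 𝓘(ℝ, SymMat n) 𝓘(ℝ, SymMat n) φ P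

theorem diff_injective (φ : Diffeo n) (P : SPD n) : Function.Injective (diff φ P) :=
  (φ.mfderivToContinuousLinearEquiv (by simp) P).injective

/-- The tangent bundle of `SPD n` is trivialized by the global chart. -/
theorem symmL_trivialization (P Q : SPD n) (v : SymMat n) :
    (trivializationAt (SymMat n) (TangentSpace 𝓘(ℝ, SymMat n)) P).symmL ℝ Q v = v := by
  have hs : Q ∈ (chartAt (SymMat n) P).source := mem_chart_source (SymMat n) Q
  rw [TangentBundle.symmL_trivializationAt_eq_core hs]
  exact (tangentBundleCore 𝓘(ℝ, SymMat n) (SPD n)).coordChange_self (achart (SymMat n) Q) Q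
    (mem_chart_source (SymMat n) Q) v

/-- `diff φ P` as an endomorphism of `SymMat n`, with `T P` unfolded. -/
def diffL (φ : Diffeo n) (P : SPD n) : SymMat n →L[ℝ] SymMat n := diff φ P

theorem contMDiff_diff (φ : Diffeo n) :
    ContMDiff 𝓘(ℝ, SymMat n) 𝓘(ℝ, SymMat n →L[ℝ] SymMat n) ∞ (diffL φ) := by
  intro P
  convert! (φ.contMDiff P).mfderiv_const (m := ∞) (by simp) using 1
  ext Q v : 2
  simp only [inTangentCoordinates, ContinuousLinearMap.inCoordinates,
    TangentBundle.continuousLinearMapAt_model_space]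
  change diff φ Q v =
    diff φ Q ((trivializationAt (SymMat n) (TangentSpace 𝓘(ℝ, SymMat n)) P).symmL ℝ Q v)
  rw [symmL_trivialization]

/-- The Frobenius inner product as a continuous bilinear form. -/
def frobenius (n : ℕ) : SymMat n →L[ℝ] SymMat n →L[ℝ] ℝ := innerSL ℝ

/-- `(V, W) ↦ ⟨φ_{*,P} V, φ_{*,P} W⟩`. -/
def pemInner (φ : Diffeo n) (P : SPD n) : T P →L[ℝ] T P →L[ℝ] ℝ :=
  (frobenius n).bilinearComp (diffL φ P) (diffL φ P)

theorem pemInner_apply (φ : Diffeo n) (P : SPD n) (V W : T P) :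
    pemInner φ P V W = inner ℝ (diff φ P V) (diff φ P W) := rfl

/-- The pullback Euclidean metric `g_P(V, W) = ⟨φ_{*,P} V, φ_{*,P} W⟩` of a diffeomorphism `φ`. -/
def pem (φ : Diffeo n) : Metric n where
  inner := pemInner φ
  symm P v w := real_inner_comm (diffL φ P w) (diffL φ P v)
  pos P v hv := by
    change 0 < inner ℝ (diff φ P v) (diff φ P v)
    exact real_inner_self_pos.2 fun h => hv (diff_injective φ P (h.trans (map_zero _).symm))
  isVonNBounded P := by
    let e : T P ≃L[ℝ] SymMat n := φ.mfderivToContinuousLinearEquiv (by simp) P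
    have h := (NormedSpace.isVonNBounded_ball ℝ (SymMat n) 1).image
      (e.symm : SymMat n →L[ℝ] T P)
    refine h.subset fun v hv => ?_
    refine ⟨e v, ?_, e.symm_apply_apply v⟩
    have hv' : inner ℝ (e v) (e v) < 1 := hv
    rw [real_inner_self_eq_norm_sq] at hv'
    rw [mem_ball_zero_iff]
    nlinarith [norm_nonneg (e v)]
  contMDiff := by
    intro P
    rw [Bundle.contMDiffAt_section]
    have hB : ContDiff ℝ ∞ fun L : SymMat n →L[ℝ] SymMat n => (frobenius n).bilinearComp L L := by
      have hf : ContDiff ℝ ∞ (ContinuousLinearMap.flipₗᵢ ℝ (SymMat n) (SymMat n) ℝ) :=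
        LinearIsometryEquiv.contDiff _
      exact hf.comp ((hf.comp (contDiff_const.clm_comp contDiff_id)).clm_comp contDiff_id)
    have h : ContMDiff 𝓘(ℝ, SymMat n) 𝓘(ℝ, SymMat n →L[ℝ] SymMat n →L[ℝ] ℝ) ∞
        (fun Q : SPD n => (frobenius n).bilinearComp (diffL φ Q) (diffL φ Q)) :=
      hB.contMDiff.comp (contMDiff_diff φ)
    convert! h P using 1
    ext Q v w
    simp only [ContinuousLinearMap.inCoordinates, hom_trivializationAt_apply]
    have hQ : Q ∈ (chartAt (SymMat n) P).source ∩
        (Bundle.Trivial.trivialization (SPD n) ℝ).baseSet :=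
      ⟨mem_chart_source (SymMat n) Q, Set.mem_univ _⟩
    simp [Bundle.Trivialization.linearMapAt_apply, hom_trivializationAt_apply,
      ContinuousLinearMap.inCoordinates]
    erw [if_pos hQ]
    change pemInner φ Q ((trivializationAt (SymMat n) (TangentSpace 𝓘(ℝ, SymMat n)) P).symmL ℝ Q v)
      ((trivializationAt (SymMat n) (TangentSpace 𝓘(ℝ, SymMat n)) P).symmL ℝ Q w) = _
    rw [symmL_trivialization, symmL_trivialization]
    rfl

/-! ### Riemannian geometry of `(SPD n, g)`

`SPD n` is an open subset of the vector space `SymMat n`, which serves as a global chart: a vector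
`X : SymMat n` is a constant coordinate vector field. -/

/-- The derivative at `P`, in the direction `X`, of the function `Q ↦ g_Q(Y, Z)`, where `Y` and `Z`
are constant vector fields. -/
def metricDeriv (g : Metric n) (P : SPD n) (X Y Z : SymMat n) : ℝ :=
  mfderiv 𝓘(ℝ, SymMat n) 𝓘(ℝ, ℝ) (fun Q : SPD n => g.inner Q Y Z) P X

/-- `g_P(∇_X Y, Z)` for the Levi-Civita connection `∇` of `g` and constant vector fields `X`, `Y`,
`Z`, as given by the Koszul formula (the Christoffel symbols of the first kind). -/
def christoffel (g : Metric n) (P : SPD n) (X Y Z : SymMat n) : ℝ :=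
  (metricDeriv g P X Y Z + metricDeriv g P Y X Z - metricDeriv g P Z X Y) / 2

/-- The velocity of a curve in `SPD n`, in the global chart. -/
def velocity (γ : ℝ → SPD n) (t : ℝ) : SymMat n := deriv (fun s => (γ s : SymMat n)) t

/-- `g(D_t V, Z)` at time `t`, where `D_t V = V' + ∇_{γ'} V` is the Levi-Civita covariant derivative
of the vector field `V` along `γ`. -/
def covDerivPairing (g : Metric n) (γ : ℝ → SPD n) (V : ℝ → SymMat n) (t : ℝ) (Z : SymMat n) : ℝ :=
  g.inner (γ t) (deriv V t) Z + christoffel g (γ t) (velocity γ t) (V t) Z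

/-- `V` is a smooth parallel vector field along `γ` on the open set `J` of times. -/
structure IsParallelOn (g : Metric n) (γ : ℝ → SPD n) (V : ℝ → SymMat n) (J : Set ℝ) : Prop where
  smooth : ContDiffOn ℝ ∞ V J
  parallel : ∀ t ∈ J, ∀ Z : SymMat n, covDerivPairing g γ V t Z = 0

/-- `γ` is a geodesic on the open set `J` of times: a smooth curve with parallel velocity. -/
structure IsGeodesicOn (g : Metric n) (γ : ℝ → SPD n) (J : Set ℝ) : Prop where
  smooth : ContDiffOn ℝ ∞ (fun t => (γ t : SymMat n)) J
  parallel : IsParallelOn g γ (velocity γ) J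

/-- `γ` restricted to `[0, 1]` is a geodesic segment from `P` to `Q`; it is a geodesic on the
neighbourhood `J` of `[0, 1]`. -/
structure IsGeodesicFromTo (g : Metric n) (γ : ℝ → SPD n) (J : Set ℝ) (P Q : SPD n) : Prop where
  isOpen : IsOpen J
  subset : Set.Icc 0 1 ⊆ J
  geodesic : IsGeodesicOn g γ J
  source : γ 0 = P
  target : γ 1 = Q

/-- `exp_P V = Q`: the geodesic that starts at `P` with velocity `V` is at `Q` at time `1`. -/
def IsLog (g : Metric n) (P Q : SPD n) (V : T P) : Prop :=
  ∃ (γ : ℝ → SPD n) (J : Set ℝ), IsGeodesicFromTo g γ J P Q ∧ velocity γ 0 = V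

/-- The Riemannian logarithm `Log_P Q`, the inverse of the exponential map (an arbitrary vector if
there is no `V` with `exp_P V = Q`). -/
def riemLog (g : Metric n) (P Q : SPD n) : T P := Classical.epsilon (IsLog g P Q)

/-- `W ∈ T_Q` is obtained from `V ∈ T_P` by parallel transport along a geodesic from `P` to `Q`. -/
def IsTransport (g : Metric n) (P Q : SPD n) (V : T P) (W : T Q) : Prop :=
  ∃ (γ : ℝ → SPD n) (J : Set ℝ) (X : ℝ → SymMat n),
    IsGeodesicFromTo g γ J P Q ∧ IsParallelOn g γ X J ∧ X 0 = V ∧ X 1 = W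

/-- The parallel transport `Γ_{P → Q} V` along the geodesic from `P` to `Q` (an arbitrary vector if
there is no such geodesic). -/
def transport (g : Metric n) (P Q : SPD n) (V : T P) : T Q :=
  Classical.epsilon (IsTransport g P Q V)

open scoped Bundle in
/-- The geodesic distance of `g`: the infimum of the `g`-lengths of the `C^1` paths from `P` to
`Q`. -/
def geodesicDist (g : Metric n) (P Q : SPD n) : ℝ :=
  letI : Bundle.RiemannianBundle (fun P : SPD n => TangentSpace 𝓘(ℝ, SymMat n) P) :=
    ⟨g.toRiemannianMetric⟩
  (Manifold.riemannianEDist 𝓘(ℝ, SymMat n) P Q).toReal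

/-- The norm `‖A‖_P` of a tangent vector. -/
def tangentNorm (g : Metric n) (P : SPD n) (A : T P) : ℝ := √(g.inner P A A)

/-- The SPD hyperplane `H_{A,P} = {S | g_P(Log_P S, A) = 0}`. -/
def hyperplane (g : Metric n) (P : SPD n) (A : T P) : Set (SPD n) :=
  {S | g.inner P (riemLog g P S) A = 0}

/-- The margin distance from `S` to a set `H` of SPD matrices. -/
def marginDist (g : Metric n) (S : SPD n) (H : Set (SPD n)) : ℝ := ⨅ Q : H, geodesicDist g S Q

/-- The score `sign(⟨A, Log_P S⟩_P) ‖A‖_P d(S, H_{A,P})` of a class with parameters `P`, `A`. -/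
def score (g : Metric n) (P : SPD n) (A : T P) (S : SPD n) : ℝ :=
  Real.sign (g.inner P A (riemLog g P S)) * tangentNorm g P A * marginDist g S (hyperplane g P A)

/-- SPD multinomial logistic regression with `C` classes: the probability `p(y = k | S)`, which is
proportional to the exponential of the score of class `k` and sums to `1` over the classes. -/
def mlr (g : Metric n) {C : ℕ} (P : Fin C → SPD n) (A : ∀ k, T (P k)) (S : SPD n) (k : Fin C) : ℝ :=
  Real.exp (score g (P k) (A k) S) / ∑ j, Real.exp (score g (P j) (A j) S)

end SPD
end

noncomputable section

namespace SPD

variable {n : ℕ}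

/-! The pullback metric makes `φ` an isometry onto the flat space of symmetric matrices, so all the
geometry can be read off there. In the global chart the Levi-Civita derivative of a field `V` along
a curve becomes the ordinary derivative of its image under the differential of `φ`
(`covDerivPairing_pem`). Hence geodesics are preimages of segments, the logarithm corresponds to `φ
Q - φ P` (`isLog_pem_iff`), and transport keeps the image under the differential fixed
(`isTransport_pem_iff`).

Lengths of paths are preserved as well, so the distance is `‖φ P - φ Q‖` (`geodesicDist_pem`). An
SPD hyperplane is thus the preimage of an affine hyperplane with normal `diff φ P A`, and the margin
distance is the absolute inner product divided by the norm of this normal. That norm is `‖A‖_P`, so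
it cancels in the score, and the sign removes the absolute value (`score_pem`). -/

/-! ### Calculus in the global chart -/

theorem hasMFDerivAt_of_hasFDerivAt {E : Type*} [NormedAddCommGroup E] [NormedSpace ℝ E]
    {u : SPD n → E} {f : SymMat n → E} (huf : ∀ Q : SPD n, u Q = f Q) {P : SPD n}
    {f' : SymMat n →L[ℝ] E} (hf : HasFDerivAt f f' (P : SymMat n)) :
    HasMFDerivAt 𝓘(ℝ, SymMat n) 𝓘(ℝ, E) u P f' := by
  obtain rfl : u = f ∘ Subtype.val := funext huf
  refine ⟨hf.continuousAt.comp continuous_subtype_val.continuousAt, ?_⟩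
  -- The chart of an open subset is the inclusion, so the coordinate expression of `u` near `P` is
  -- `f`.
  have h : (f ∘ Subtype.val) ∘ (chartAt (SymMat n) P).symm =ᶠ[nhds (P : SymMat n)] f :=
    ((TopologicalSpace.Opens.chartAt_subtype_val_symm_eventuallyEq (SPD n) (x := P)).fun_comp f).symm
  exact (hf.congr_of_eventuallyEq h).hasFDerivWithinAt

/-- A diffeomorphism of `SPD n`, extended by zero to all symmetric matrices. -/
def extend (φ : Diffeo n) : SymMat n → SymMat n := Function.extend Subtype.val φ 0

theorem extend_coe (φ : Diffeo n) (P : SPD n) : extend φ P = φ P :=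
  Subtype.val_injective.extend_apply _ _ P

/-- The junk value zero plays no role, since positive definiteness is an open condition. -/
theorem contDiffAt_extend (φ : Diffeo n) (P : SPD n) : ContDiffAt ℝ ∞ (extend φ) P := by
  rw [← contMDiffAt_iff_contDiffAt, ← contMDiffAt_subtype_iff]
  exact (φ.contMDiff P).congr_of_eventuallyEq (.of_forall fun Q => extend_coe φ Q)

theorem diff_eq_fderiv (φ : Diffeo n) (P : SPD n) :
    diff φ P = fderiv ℝ (extend φ) (P : SymMat n) :=
  (hasMFDerivAt_of_hasFDerivAt (fun Q => (extend_coe φ Q).symm)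
    ((contDiffAt_extend φ P).differentiableAt (by simp)).hasFDerivAt).mfderiv

theorem diffL_eq_fderiv (φ : Diffeo n) (P : SPD n) :
    diffL φ P = fderiv ℝ (extend φ) (P : SymMat n) := diff_eq_fderiv φ P

theorem differentiableAt_fderiv_extend (φ : Diffeo n) (P : SPD n) :
    DifferentiableAt ℝ (fderiv ℝ (extend φ)) P :=
  ((contDiffAt_extend φ P).fderiv_right (m := ∞) (by simp)).differentiableAt (by simp)

theorem pem_inner (φ : Diffeo n) (P : SPD n) (V W : SymMat n) :
    (pem φ).inner P V W =
      inner ℝ (fderiv ℝ (extend φ) P V) (fderiv ℝ (extend φ) P W) := by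
  rw [← diffL_eq_fderiv]
  rfl

theorem diff_surjective (φ : Diffeo n) (P : SPD n) : Function.Surjective (diff φ P) :=
  (φ.mfderivToContinuousLinearEquiv (by simp) P).surjective

theorem contDiff_symm (φ : Diffeo n) : ContDiff ℝ ∞ fun y => (φ.symm y : SymMat n) := by
  rw [← contMDiff_iff_contDiff]
  exact contMDiff_subtype_val.comp φ.symm.contMDiff

/-! ### The Levi-Civita connection of the pullback metric -/

theorem metricDeriv_pem (φ : Diffeo n) (P : SPD n) (X Y Z : SymMat n) :
    metricDeriv (pem φ) P X Y Z =
      inner ℝ (fderiv ℝ (extend φ) P Y) (fderiv ℝ (fderiv ℝ (extend φ)) P X Z) +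
        inner ℝ (fderiv ℝ (fderiv ℝ (extend φ)) P X Y) (fderiv ℝ (extend φ) P Z) := by
  have hd : HasFDerivAt (fderiv ℝ (extend φ)) (fderiv ℝ (fderiv ℝ (extend φ)) P) P :=
    (differentiableAt_fderiv_extend φ P).hasFDerivAt
  have hYZ := (hd.clm_apply (hasFDerivAt_const Y (P : SymMat n))).inner ℝ
    (hd.clm_apply (hasFDerivAt_const Z (P : SymMat n)))
  have h := hasMFDerivAt_of_hasFDerivAt (u := fun Q : SPD n => (pem φ).inner Q Y Z)
    (fun Q => pem_inner φ Q Y Z) hYZ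
  refine (congrArg (fun L : SymMat n →L[ℝ] ℝ => L X) h.mfderiv).trans ?_
  simp

/-- The product rule turns the Koszul formula into six terms; by symmetry of the second derivative
four of them cancel and the other two agree. -/
theorem christoffel_pem (φ : Diffeo n) (P : SPD n) (X Y Z : SymMat n) :
    christoffel (pem φ) P X Y Z =
      inner ℝ (fderiv ℝ (fderiv ℝ (extend φ)) P X Y) (fderiv ℝ (extend φ) P Z) := by
  have hs : IsSymmSndFDerivAt ℝ (extend φ) P :=
    (contDiffAt_extend φ P).isSymmSndFDerivAt
      (by simpa using WithTop.coe_le_coe.2 (le_top (a := (2 : ℕ∞))))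
  rw [christoffel, metricDeriv_pem, metricDeriv_pem, metricDeriv_pem, hs.eq Y X, hs.eq Z X,
    hs.eq Z Y, real_inner_comm (fderiv ℝ (extend φ) P Y) (fderiv ℝ (fderiv ℝ (extend φ)) P X Z)]
  ring

/-- The product rule splits the derivative of `Dφ(V)` into `Dφ(V')` and `D²φ(γ', V)`; paired with
`Dφ(Z)`, these are the metric term and the Christoffel term. -/
theorem covDerivPairing_pem (φ : Diffeo n) {γ : ℝ → SPD n} {V : ℝ → SymMat n} {t : ℝ}
    (hγ : DifferentiableAt ℝ (fun s => (γ s : SymMat n)) t) (hV : DifferentiableAt ℝ V t)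
    (Z : SymMat n) :
    covDerivPairing (pem φ) γ V t Z =
      inner ℝ (deriv (fun s => diffL φ (γ s) (V s)) t) (diffL φ (γ t) Z) := by
  have hd : HasFDerivAt (fderiv ℝ (extend φ)) (fderiv ℝ (fderiv ℝ (extend φ)) (γ t)) (γ t) :=
    (differentiableAt_fderiv_extend φ (γ t)).hasFDerivAt
  have hD : HasDerivAt (fun s => fderiv ℝ (extend φ) (γ s))
      (fderiv ℝ (fderiv ℝ (extend φ)) (γ t) (velocity γ t)) t :=
    hd.comp_hasDerivAt t hγ.hasDerivAt
  have h := hD.clm_apply hV.hasDerivAt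
  have he : (fun s => diffL φ (γ s) (V s)) = fun s => fderiv ℝ (extend φ) (γ s) (V s) :=
    funext fun s => by rw [diffL_eq_fderiv]
  rw [he, h.deriv, diffL_eq_fderiv, inner_add_left, add_comm, ← christoffel_pem,
    ← pem_inner]
  rfl

theorem isParallelOn_pem_iff (φ : Diffeo n) {γ : ℝ → SPD n} {V : ℝ → SymMat n} {J : Set ℝ}
    (hJ : IsOpen J) (hγ : ContDiffOn ℝ ∞ (fun s => (γ s : SymMat n)) J) :
    IsParallelOn (pem φ) γ V J ↔
      ContDiffOn ℝ ∞ V J ∧ ∀ t ∈ J, deriv (fun s => diffL φ (γ s) (V s)) t = 0 := by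
  have key (hV : ContDiffOn ℝ ∞ V J) (t : ℝ) (ht : t ∈ J) := covDerivPairing_pem φ
    ((hγ.contDiffAt (hJ.mem_nhds ht)).differentiableAt (by simp))
    ((hV.contDiffAt (hJ.mem_nhds ht)).differentiableAt (by simp))
  refine ⟨fun h => ⟨h.smooth, fun t ht => ?_⟩, fun h => ⟨h.1, fun t ht Z => ?_⟩⟩
  -- With this `Z` the pairing is the squared norm of the derivative.
  · obtain ⟨Z, hZ⟩ := diff_surjective φ (γ t) (deriv (fun s => diffL φ (γ s) (V s)) t)
    have h0 := h.parallel t ht Z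
    have h1 : inner ℝ _ (diff φ (γ t) Z) = 0 := (key h.smooth t ht Z).symm.trans h0
    rwa [hZ, inner_self_eq_zero] at h1
  · rw [key h.1 t ht, h.2 t ht, inner_zero_left]

theorem hasDerivAt_comp_curve (φ : Diffeo n) {γ : ℝ → SPD n} {t : ℝ}
    (hγ : DifferentiableAt ℝ (fun s => (γ s : SymMat n)) t) :
    HasDerivAt (fun s => φ (γ s)) (diffL φ (γ t) (velocity γ t)) t := by
  have h := ((contDiffAt_extend φ (γ t)).differentiableAt (by simp)).hasFDerivAt.comp_hasDerivAt t
    hγ.hasDerivAt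
  rw [diffL_eq_fderiv]
  exact h.congr_of_eventuallyEq (.of_forall fun s => (extend_coe φ (γ s)).symm)

theorem differentiableAt_diffL_apply (φ : Diffeo n) {γ : ℝ → SPD n} {V : ℝ → SymMat n} {t : ℝ}
    (hγ : DifferentiableAt ℝ (fun s => (γ s : SymMat n)) t) (hV : DifferentiableAt ℝ V t) :
    DifferentiableAt ℝ (fun s => diffL φ (γ s) (V s)) t := by
  have h := ((differentiableAt_fderiv_extend φ (γ t)).comp t hγ).clm_apply hV
  refine h.congr_of_eventuallyEq (.of_forall fun s => ?_)
  simp only [Function.comp_apply, diffL_eq_fderiv]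

/-- The set `J` need not be connected, so constancy is claimed on `[0, 1]` only. -/
theorem diffL_apply_eq_of_isParallelOn (φ : Diffeo n) {γ : ℝ → SPD n} {V : ℝ → SymMat n}
    {J : Set ℝ} (hJ : IsOpen J) (hsub : Set.Icc 0 1 ⊆ J)
    (hγ : ContDiffOn ℝ ∞ (fun s => (γ s : SymMat n)) J) (hV : IsParallelOn (pem φ) γ V J)
    {t : ℝ} (ht : t ∈ Set.Icc (0 : ℝ) 1) : diffL φ (γ t) (V t) = diffL φ (γ 0) (V 0) := by
  have hdiff (s : ℝ) (hs : s ∈ Set.Icc (0 : ℝ) 1) :=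
    differentiableAt_diffL_apply φ
      ((hγ.contDiffAt (hJ.mem_nhds (hsub hs))).differentiableAt (by simp))
      ((hV.smooth.contDiffAt (hJ.mem_nhds (hsub hs))).differentiableAt (by simp))
  refine constant_of_has_deriv_right_zero (f := fun s => diffL φ (γ s) (V s))
    (fun s hs => (hdiff s hs).continuousAt.continuousWithinAt) (fun s hs => ?_) t ht
  have h := (hdiff s (Set.Ico_subset_Icc_self hs)).hasDerivAt
  rw [((isParallelOn_pem_iff φ hJ hγ).1 hV).2 s (hsub (Set.Ico_subset_Icc_self hs))] at h
  exact h.hasDerivWithinAt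

/-! ### Geodesics, logarithm and parallel transport -/

/-- The pullback under `φ` of the segment from `φ P` to `φ Q`. -/
def segmentCurve (φ : Diffeo n) (P Q : SPD n) (t : ℝ) : SPD n := φ.symm (φ P + t • (φ Q - φ P))

theorem contDiff_segmentCurve (φ : Diffeo n) (P Q : SPD n) :
    ContDiff ℝ ∞ fun t => (segmentCurve φ P Q t : SymMat n) :=
  (contDiff_symm φ).comp (contDiff_const.add (contDiff_id.smul contDiff_const))

theorem apply_segmentCurve (φ : Diffeo n) (P Q : SPD n) (t : ℝ) :
    φ (segmentCurve φ P Q t) = φ P + t • (φ Q - φ P) := φ.apply_symm_apply _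

theorem diffL_velocity_segmentCurve (φ : Diffeo n) (P Q : SPD n) (t : ℝ) :
    diffL φ (segmentCurve φ P Q t) (velocity (segmentCurve φ P Q) t) = φ Q - φ P := by
  have h := hasDerivAt_comp_curve φ
    ((contDiff_segmentCurve φ P Q).contDiffAt.differentiableAt (x := t) (by simp))
  simp only [apply_segmentCurve] at h
  have h' := ((hasDerivAt_id t).smul_const (φ Q - φ P)).const_add (φ P)
  simpa using h.unique h'

theorem isGeodesicFromTo_segmentCurve (φ : Diffeo n) (P Q : SPD n) :
    IsGeodesicFromTo (pem φ) (segmentCurve φ P Q) Set.univ P Q where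
  isOpen := isOpen_univ
  subset := Set.subset_univ _
  geodesic :=
    ⟨(contDiff_segmentCurve φ P Q).contDiffOn,
      (isParallelOn_pem_iff φ isOpen_univ (contDiff_segmentCurve φ P Q).contDiffOn).2
        ⟨((contDiff_infty_iff_deriv.1 (contDiff_segmentCurve φ P Q)).2).contDiffOn, fun t _ => by
          simp only [diffL_velocity_segmentCurve, deriv_const]⟩⟩
  source := by simp [segmentCurve]
  target := by simp [segmentCurve]

theorem isLog_pem_iff (φ : Diffeo n) (P Q : SPD n) (V : T P) :
    IsLog (pem φ) P Q V ↔ diff φ P V = φ Q - φ P := by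
  have key {W : T P} (h : IsLog (pem φ) P Q W) : diff φ P W = φ Q - φ P := by
    obtain ⟨γ, J, ⟨hJ, hsub, ⟨hγ, hpar⟩, rfl, rfl⟩, rfl⟩ := h
    -- The image of a geodesic has constant velocity, so subtracting its linear part leaves a
    -- constant; comparing times 0 and 1 gives the claim.
    have hd (t : ℝ) (ht : t ∈ Set.Icc (0 : ℝ) 1) :
        HasDerivAt (fun s => φ (γ s) - s • diffL φ (γ 0) (velocity γ 0)) 0 t := by
      have h1 := hasDerivAt_comp_curve φ
        ((hγ.contDiffAt (hJ.mem_nhds (hsub ht))).differentiableAt (by simp))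
      rw [diffL_apply_eq_of_isParallelOn φ hJ hsub hγ hpar ht] at h1
      simpa using! h1.sub ((hasDerivAt_id t).smul_const (diffL φ (γ 0) (velocity γ 0)))
    have h := constant_of_has_deriv_right_zero
      (fun t ht => (hd t ht).continuousAt.continuousWithinAt)
      (fun t ht => (hd t (Set.Ico_subset_Icc_self ht)).hasDerivWithinAt) 1 (by simp)
    simp only [one_smul, zero_smul, sub_zero] at h
    exact (sub_eq_iff_eq_add.2 (sub_eq_iff_eq_add'.1 h)).symm
  refine ⟨key, fun h => ?_⟩
  -- The pulled back segment has some initial velocity, which injectivity of the differential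
  -- identifies with `V`.
  have hlog : IsLog (pem φ) P Q (velocity (segmentCurve φ P Q) 0) :=
    ⟨_, _, isGeodesicFromTo_segmentCurve φ P Q, rfl⟩
  rwa [diff_injective φ P (h.trans (key hlog).symm)]

theorem isTransport_pem_iff (φ : Diffeo n) (P Q : SPD n) (V : T P) (W : T Q) :
    IsTransport (pem φ) P Q V W ↔ diff φ Q W = diff φ P V := by
  have key {W : T Q} (h : IsTransport (pem φ) P Q V W) : diff φ Q W = diff φ P V := by
    obtain ⟨γ, J, X, ⟨hJ, hsub, ⟨hγ, -⟩, rfl, rfl⟩, hX, rfl, rfl⟩ := h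
    exact diffL_apply_eq_of_isParallelOn φ hJ hsub hγ hX (by simp)
  refine ⟨key, fun h => ?_⟩
  -- The parallel field is a constant vector pushed forward by the inverse of `φ` along the segment.
  let X (t : ℝ) : SymMat n :=
    fderiv ℝ (fun y => (φ.symm y : SymMat n)) (φ P + t • (φ Q - φ P)) (diff φ P V)
  have hXs : ContDiff ℝ ∞ X :=
    (((contDiff_symm φ).fderiv_right (m := ∞) (by simp)).comp
      (contDiff_const.add (contDiff_id.smul contDiff_const))).clm_apply contDiff_const
  have hX (t : ℝ) : diffL φ (segmentCurve φ P Q t) (X t) = diff φ P V := by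
    have h1 := ((contDiffAt_extend φ (segmentCurve φ P Q t)).differentiableAt
      (by simp)).hasFDerivAt.comp (φ P + t • (φ Q - φ P))
      ((contDiff_symm φ).contDiffAt.differentiableAt (by simp)).hasFDerivAt
    -- The chain rule for this identity shows that the two differentials are inverse to each other.
    have h2 : (extend φ ∘ fun y => (φ.symm y : SymMat n)) = id :=
      funext fun y => (extend_coe φ _).trans (φ.apply_symm_apply y)
    rw [h2] at h1
    rw [diffL_eq_fderiv]
    exact congrArg (fun L : SymMat n →L[ℝ] SymMat n => L (diff φ P V)) (h1.unique (hasFDerivAt_id _))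
  have hseg := isGeodesicFromTo_segmentCurve φ P Q
  have h0 : X 0 = V := by
    have := hX 0
    rw [hseg.source] at this
    exact diff_injective φ P this
  have h1 : X 1 = W := by
    have := hX 1
    rw [hseg.target] at this
    exact diff_injective φ Q (this.trans h.symm)
  exact ⟨_, _, X, hseg, (isParallelOn_pem_iff φ isOpen_univ hseg.geodesic.smooth).2
    ⟨hXs.contDiffOn, fun t _ => by simp only [hX, deriv_const]⟩, h0, h1⟩

theorem existsUnique_isLog (φ : Diffeo n) (P Q : SPD n) : ∃! V : T P, IsLog (pem φ) P Q V := by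
  simp only [isLog_pem_iff]
  exact Function.Bijective.existsUnique ⟨diff_injective φ P, diff_surjective φ P⟩ _

theorem existsUnique_isTransport (φ : Diffeo n) (P Q : SPD n) (V : T P) :
    ∃! W : T Q, IsTransport (pem φ) P Q V W := by
  simp only [isTransport_pem_iff]
  exact Function.Bijective.existsUnique ⟨diff_injective φ Q, diff_surjective φ Q⟩ _

theorem diff_riemLog (φ : Diffeo n) (P Q : SPD n) :
    diff φ P (riemLog (pem φ) P Q) = φ Q - φ P :=
  (isLog_pem_iff φ P Q _).1 (Classical.epsilon_spec (existsUnique_isLog φ P Q).exists)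

theorem diff_transport (φ : Diffeo n) (P Q : SPD n) (V : T P) :
    diff φ Q (transport (pem φ) P Q V) = diff φ P V :=
  (isTransport_pem_iff φ P Q V _).1 (Classical.epsilon_spec (existsUnique_isTransport φ P Q V).exists)

/-! ### Distances -/

theorem iInf_norm_sub_hyperplane {E : Type*} [NormedAddCommGroup E] [InnerProductSpace ℝ E]
    {x a b : E} (hb : b ≠ 0) :
    ⨅ y : {y : E | inner ℝ (y - a) b = 0}, ‖x - y‖ = |inner ℝ (x - a) b| / ‖b‖ := by
  have hb' : 0 < ‖b‖ := norm_pos_iff.2 hb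
  have : Nonempty {y : E | inner ℝ (y - a) b = 0} := ⟨a, by simp⟩
  refine le_antisymm ?_ (le_ciInf fun y => ?_)
  -- `x - c • b` is the foot of the perpendicular from `x`; the opposite bound is Cauchy–Schwarz.
  · let c : ℝ := inner ℝ (x - a) b / ‖b‖ ^ 2
    have hc : x - c • b ∈ {y : E | inner ℝ (y - a) b = 0} := by
      change inner ℝ (x - c • b - a) b = 0
      rw [sub_right_comm, inner_sub_left, inner_smul_left, real_inner_self_eq_norm_sq]
      simp [c, hb]
    refine (ciInf_le ⟨0, Set.forall_mem_range.2 fun _ => norm_nonneg _⟩ ⟨_, hc⟩).trans_eq ?_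
    change ‖x - (x - c • b)‖ = _
    rw [sub_sub_cancel, norm_smul, Real.norm_eq_abs, abs_div, abs_of_pos (by positivity : 0 < ‖b‖ ^ 2)]
    field_simp
  · rw [div_le_iff₀ hb']
    have hy : inner ℝ (x - a) b = inner ℝ (x - (y : E)) b := by
      have h : inner ℝ ((y : E) - a) b = 0 := y.2
      rw [← sub_add_sub_cancel x (y : E) a, inner_add_left, h, add_zero]
    rw [hy]
    exact abs_real_inner_le_norm _ _

open scoped Bundle in
theorem geodesicDist_pem (φ : Diffeo n) (P Q : SPD n) :
    geodesicDist (pem φ) P Q = ‖φ P - φ Q‖ := by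
  let _ : Bundle.RiemannianBundle (fun P : SPD n => TangentSpace 𝓘(ℝ, SymMat n) P) :=
    ⟨(pem φ).toRiemannianMetric⟩
  have hnorm (R : SPD n) (v : T R) : ‖v‖ₑ = ‖(diff φ R v : TangentSpace 𝓘(ℝ, SymMat n) (φ R))‖ₑ := by
    refine Eq.trans ?_ (enorm_tangentSpace_vectorSpace (x := φ R) (v := diff φ R v)).symm
    refine enorm_eq_iff_norm_eq.2 ?_
    rw [norm_eq_sqrt_real_inner, norm_eq_sqrt_real_inner]
    rfl
  have hlen {γ : ℝ → SPD n}
      (hγ : ContMDiffOn 𝓘(ℝ, ℝ) 𝓘(ℝ, SymMat n) 1 γ (Set.Icc 0 1)) :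
      Manifold.pathELength 𝓘(ℝ, SymMat n) γ 0 1 =
        Manifold.pathELength 𝓘(ℝ, SymMat n) (φ ∘ γ) 0 1 := by
    simp only [Manifold.pathELength_eq_lintegral_mfderivWithin_Icc]
    refine MeasureTheory.setLIntegral_congr_fun measurableSet_Icc fun t ht => ?_
    have h : mfderivWithin 𝓘(ℝ, ℝ) 𝓘(ℝ, SymMat n) (φ ∘ γ) (Set.Icc 0 1) t =
        (diff φ (γ t)).comp (mfderivWithin 𝓘(ℝ, ℝ) 𝓘(ℝ, SymMat n) γ (Set.Icc 0 1) t) :=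
      mfderiv_comp_mfderivWithin t (φ.contMDiff.mdifferentiable (by simp) _)
        (hγ.mdifferentiableOn (by simp) t ht)
        (uniqueMDiffWithinAt_iff_uniqueDiffWithinAt.2 (uniqueDiffOn_Icc one_pos t ht))
    simp only [h]
    exact hnorm _ _
  have hdist : Manifold.riemannianEDist 𝓘(ℝ, SymMat n) P Q = edist (φ P) (φ Q) := by
    -- The norm distance is itself an infimum of path lengths, so it suffices to carry paths across
    -- by `φ` and its inverse.
    rw [IsRiemannianManifold.out (I := 𝓘(ℝ, SymMat n)) (φ P) (φ Q)]
    refine le_antisymm (le_of_forall_gt fun r hr => ?_) (le_of_forall_gt fun r hr => ?_)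
    · obtain ⟨γ, h0, h1, hγ, hr⟩ := Manifold.exists_lt_of_riemannianEDist_lt hr
      have hγ' : ContMDiffOn 𝓘(ℝ, ℝ) 𝓘(ℝ, SymMat n) 1 (φ.symm ∘ γ) (Set.Icc 0 1) :=
        (φ.symm.contMDiff.of_le (by simp)).comp_contMDiffOn hγ
      refine (Manifold.riemannianEDist_le_pathELength hγ' (by simp [h0]) (by simp [h1])
        zero_le_one).trans_lt ?_
      rw [hlen hγ']
      convert! hr using 2
      ext1 t
      exact φ.apply_symm_apply _
    · obtain ⟨γ, h0, h1, hγ, hr⟩ := Manifold.exists_lt_of_riemannianEDist_lt hr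
      refine (Manifold.riemannianEDist_le_pathELength
        ((φ.contMDiff.of_le (by simp)).comp_contMDiffOn hγ) (by simp [h0]) (by simp [h1])
        zero_le_one).trans_lt ?_
      rwa [← hlen hγ]
  calc geodesicDist (pem φ) P Q = (edist (φ P) (φ Q)).toReal := congrArg ENNReal.toReal hdist
    _ = ‖φ P - φ Q‖ := by rw [edist_dist, ENNReal.toReal_ofReal dist_nonneg, dist_eq_norm]

/-! ### Hyperplanes and scores -/

theorem inner_riemLog_pem (φ : Diffeo n) (P S : SPD n) (A : T P) :
    (pem φ).inner P (riemLog (pem φ) P S) A = inner ℝ (φ S - φ P) (diff φ P A) :=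
  congrArg (fun v : SymMat n => inner ℝ v (diff φ P A)) (diff_riemLog φ P S)

theorem hyperplane_pem (φ : Diffeo n) (P : SPD n) (A : T P) :
    hyperplane (pem φ) P A = {S | inner ℝ (φ S - φ P) (diff φ P A) = 0} :=
  Set.ext fun S => by
    change (pem φ).inner P (riemLog (pem φ) P S) A = 0 ↔ _
    rw [inner_riemLog_pem]
    rfl

theorem marginDist_hyperplane_pem (φ : Diffeo n) (P S : SPD n) {A : T P} (hA : A ≠ 0) :
    marginDist (pem φ) S (hyperplane (pem φ) P A) =
      |inner ℝ (φ S - φ P) (diff φ P A)| / ‖diff φ P A‖ := by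
  have hA' : diff φ P A ≠ 0 := fun h => hA (diff_injective φ P (h.trans (map_zero _).symm))
  rw [← iInf_norm_sub_hyperplane hA', hyperplane_pem, marginDist]
  simp only [geodesicDist_pem]
  exact Equiv.iInf_congr
    (φ.toEquiv.subtypeEquiv (q := fun y => inner ℝ (y - φ P) (diff φ P A) = 0) fun _ => Iff.rfl)
    fun _ => rfl

theorem score_pem (φ : Diffeo n) (P S : SPD n) {A : T P} (hA : A ≠ 0) :
    score (pem φ) P A S = inner ℝ (φ S - φ P) (diff φ P A) := by
  have hA' : diff φ P A ≠ 0 := fun h => hA (diff_injective φ P (h.trans (map_zero _).symm))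
  have hnorm : tangentNorm (pem φ) P A = ‖diff φ P A‖ := by
    rw [norm_eq_sqrt_real_inner]
    rfl
  rw [score, marginDist_hyperplane_pem φ P S hA, hnorm, (pem φ).symm, inner_riemLog_pem, mul_assoc,
    mul_div_cancel₀ _ (norm_ne_zero_iff.2 hA')]
  generalize (inner ℝ (φ S - φ P) (diff φ P A) : ℝ) = r
  rcases lt_trichotomy r 0 with hr | rfl | hr
  · rw [Real.sign_of_neg hr, abs_of_neg hr, neg_mul_neg, one_mul]
  · simp
  · rw [Real.sign_of_pos hr, abs_of_pos hr, one_mul]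

theorem transport_ne_zero (φ : Diffeo n) (P Q : SPD n) {A : T P} (hA : A ≠ 0) :
    transport (pem φ) P Q A ≠ 0 := fun h => hA <| diff_injective φ P <| by
  rw [← diff_transport φ P Q A, h, map_zero, map_zero]

end SPD

end

theorem mainTheorem1 (n : ℕ) (φ : SPD.Diffeo n) :
    -- the logarithm and the parallel transport along geodesics are well defined
    (∀ P S : SPD n, ∃! V : SPD.T P, SPD.IsLog (SPD.pem φ) P S V) ∧
    (∀ (P Q : SPD n) (V : SPD.T P), ∃! W : SPD.T Q, SPD.IsTransport (SPD.pem φ) P Q V W) ∧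
    ∀ (C : ℕ) (P : Fin C → SPD n) (A : Fin C → SPD.T (SPD.one n)), (∀ k, A k ≠ 0) →
      -- the transported normal vectors are nonzero
      (∀ k, SPD.transport (SPD.pem φ) (SPD.one n) (P k) (A k) ≠ 0) ∧
      -- the probabilities
      (∀ (S : SPD n) (k : Fin C),
        SPD.mlr (SPD.pem φ) P (fun j => SPD.transport (SPD.pem φ) (SPD.one n) (P j) (A j)) S k =
          Real.exp (inner ℝ (φ S - φ (P k)) (SPD.diff φ (SPD.one n) (A k))) /
            ∑ j, Real.exp (inner ℝ (φ S - φ (P j)) (SPD.diff φ (SPD.one n) (A j)))) ∧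
      -- the hyperplanes
      (∀ k : Fin C,
        SPD.hyperplane (SPD.pem φ) (P k)
            (SPD.transport (SPD.pem φ) (SPD.one n) (P k) (A k)) =
          {S : SPD n | inner ℝ (φ S - φ (P k)) (SPD.diff φ (SPD.one n) (A k)) = 0}) := by
  refine ⟨SPD.existsUnique_isLog φ, SPD.existsUnique_isTransport φ, fun C P A hA =>
    ⟨fun k => SPD.transport_ne_zero φ _ _ (hA k), fun S k => ?_, fun k => ?_⟩⟩
  · have h (j : Fin C) := SPD.score_pem φ (P j) S
      (SPD.transport_ne_zero φ (SPD.one n) (P j) (hA j))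
    -- Transport from the identity replaces the differential at `P j` by the one at the identity.
    simp only [SPD.diff_transport] at h
    simp only [SPD.mlr, h]
  · rw [SPD.hyperplane_pem, SPD.diff_transport]
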